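/- Let $p$ be an odd prime, $s\ge 1$, $q=p^s$, let $\mathbb F_q$ be the finite field with $q$ elements, $\chi$ its quadratic character (with $\chi(0)=0$), and $H=\{x^2 : x\in\mathbb F_q^*\}$ the subgroup of nonzero squares. For an integer $k\ge 0$ and $b\in\mathbb F_q$ let $N_H(k,b)$ be the number of $k$-element subsets $S\subseteq H$ with $\sum_{a\in S}a=b$. For complex numbers $t_1,\dots,t_k$ put $$C_k(t_1,\dots,t_k)=\sum_{c_1+2c_2+\cdots+kc_k=k}\frac{k!}{1^{c_1}c_1!\,2^{c_2}c_2!\cdots k^{c_k}c_k!}\;t_1^{c_1}t_2^{c_2}\cdots t_k^{c_k},$$ the sum being over tuples of nonnegative integers $(c_1,\dots,c_k)$ (so $C_0=1$). For $b\in\mathbb F_q^*$ and $u,v,w\in\mathbb C$ put $A_{k,b}(u,v,w)=C_k(t_1,\dots,t_k)$, where $t_i=w$ if $p\mid i$, $t_i=u$ if $p\nmid i$ and $\chi(i)=\chi(b)$, and $t_i=v$ if $p\nmid i$ and $\chi(i)=-\chi(b)$ (here $\chi(i)$ is $\chi$ of the image of $i$ in $\mathbb F_q$). **Theorem 5.1.**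 Let $b\in\mathbb F_q^*$. (1) If $p\equiv 1\pmod 4$, or $p\equiv 3\pmod 4$ and $s$ is even, then $$N_H(k,b)=\frac1q\binom{\frac{q-1}{2}}{k}-\frac{(-1)^k}{2q\,k!}\Big\{(1-\sqrt q)\,A_{k,b}\big(\tfrac{1-\sqrt q}{2},\tfrac{1+\sqrt q}{2},\tfrac{1-q}{2}\big)+(1+\sqrt q)\,A_{k,b}\big(\tfrac{1+\sqrt q}{2},\tfrac{1-\sqrt q}{2},\tfrac{1-q}{2}\big)\Big\}.$$ (2) If $p\equiv 3\pmod 4$ and $s$ is odd, then, with $\mathrm i=\sqrt{-1}$, $$N_H(k,b)=\frac1q\binom{\frac{q-1}{2}}{k}-\frac{(-1)^k}{2q\,k!}\Big\{(1+\sqrt q\,\mathrm i)\,A_{k,b}\big(\tfrac{1-\sqrt q\,\mathrm i}{2},\tfrac{1+\sqrt q\,\mathrm i}{2},\tfrac{1-q}{2}\big)+(1-\sqrt q\,\mathrm i)\,A_{k,b}\big(\tfrac{1+\sqrt q\,\mathrm i}{2},\tfrac{1-\sqrt q\,\mathrm i}{2},\tfrac{1-q}{2}\big)\Big\}.$$ 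-/

import Mathlib

open scoped Nat

/-- `N_H(k, b)`: the number of `k`-element subsets `S ⊆ H` whose elements sum to `b`. -/
def subsetSumCount {F : Type*} [AddCommMonoid F] [DecidableEq F]
    (H : Finset F) (k : ℕ) (b : F) : ℕ :=
  ((H.powersetCard k).filter (fun S => ∑ a ∈ S, a = b)).card

/-- The set `H = {x² : x ∈ F, x ≠ 0}` of nonzero squares of a finite field. -/
def nonzeroSquares (F : Type*) [Field F] [Fintype F] [DecidableEq F] : Finset F :=
  (Finset.univ.filter (fun x : F => x ≠ 0)).image (fun x => x ^ 2)

/-- `N(c₁, …, c_k) = k! / (1^{c₁} c₁! 2^{c₂} c₂! ⋯ k^{c_k} c_k!)`. When `∑ i cᵢ = k`, the division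
is exact and this is the number of permutations of `k` letters with exactly `cᵢ` cycles of
length `i` for every `i`. -/
def permTypeCount (k : ℕ) (c : ℕ → ℕ) : ℕ :=
  k ! / ∏ i ∈ Finset.Icc 1 k, (i ^ c i * (c i)!)

theorem prod_permType_eq {k : ℕ} (π : Nat.Partition k) :
    ∏ i ∈ Finset.Icc 1 k, (i ^ π.parts.count i * (π.parts.count i)!) =
      (k - (π.parts.filter (fun n => 2 ≤ n)).sum)! *
        (π.parts.filter (fun n => 2 ≤ n)).prod *
        ∏ n ∈ (π.parts.filter (fun n => 2 ≤ n)).toFinset,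
          ((π.parts.filter (fun n => 2 ≤ n)).count n)! := by
  have hle : ∀ i ∈ π.parts, i ≤ k := fun i hi => by
    have := Multiset.le_sum_of_mem hi
    rwa [π.parts_sum] at this
  have hsub : (π.parts.filter (fun n => 2 ≤ n)).toFinset ⊆ Finset.Icc 2 k := by
    intro i hi
    rw [Multiset.mem_toFinset, Multiset.mem_filter] at hi
    exact Finset.mem_Icc.2 ⟨hi.2, hle i hi.1⟩
  have hsplit := Multiset.filter_add_not (fun n => 2 ≤ n) π.parts
  have hone : π.parts.filter (fun n => ¬ 2 ≤ n) = Multiset.replicate (π.parts.count 1) 1 := by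
    rw [← Multiset.filter_eq' π.parts 1]
    refine Multiset.filter_congr fun i hi => ?_
    have := π.parts_pos hi
    omega
  have hsum : k - (π.parts.filter (fun n => 2 ≤ n)).sum = π.parts.count 1 := by
    have h := congrArg Multiset.sum hsplit
    rw [Multiset.sum_add, hone, π.parts_sum] at h
    simp at h
    omega
  have hcount : ∀ i ∈ Finset.Icc 2 k,
      (π.parts.filter (fun n => 2 ≤ n)).count i = π.parts.count i := fun i hi =>
    Multiset.count_filter_of_pos (Finset.mem_Icc.1 hi).1
  rw [hsum, Finset.prod_multiset_count_of_subset _ _ hsub]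
  rw [Finset.prod_subset hsub (f := fun n =>
    ((π.parts.filter (fun n => 2 ≤ n)).count n)!) (fun i _ hi => by
      rw [Multiset.mem_toFinset] at hi
      simp [Multiset.count_eq_zero_of_notMem hi])]
  rw [mul_assoc, ← Finset.prod_mul_distrib]
  have hplain : ∏ i ∈ Finset.Icc 2 k, (i ^ (π.parts.filter (fun n => 2 ≤ n)).count i *
        ((π.parts.filter (fun n => 2 ≤ n)).count i)!) =
      ∏ i ∈ Finset.Icc 2 k, (i ^ π.parts.count i * (π.parts.count i)!) :=
    Finset.prod_congr rfl fun i hi => by rw [hcount i hi]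
  rw [hplain]
  rcases Nat.eq_zero_or_pos k with rfl | hk
  · simp
  · rw [← Finset.insert_Icc_add_one_left_eq_Icc hk, Finset.prod_insert (by simp)]
    simp

/-- `permTypeCount` really counts: a partition `π` of `k` with `cᵢ` parts equal to `i` is the cycle
type (fixed points included) of exactly `N(c₁, …, c_k)` permutations of `k` letters. -/
theorem card_perm_of_type {k : ℕ} (π : Nat.Partition k) :
    (Finset.univ.filter
      (fun τ : Equiv.Perm (Fin k) => τ.partition.parts = π.parts)).card =
      permTypeCount k (fun i => π.parts.count i) := by
  have hle : (π.parts.filter (fun n => 2 ≤ n)).sum ≤ k := by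
    have h := congrArg Multiset.sum (Multiset.filter_add_not (fun n => 2 ≤ n) π.parts)
    rw [Multiset.sum_add, π.parts_sum] at h
    omega
  have key : ∀ τ : Equiv.Perm (Fin k), τ.partition.parts = π.parts ↔
      τ.cycleType = π.parts.filter (fun n => 2 ≤ n) := by
    intro τ
    constructor
    · intro h
      rw [← h, Equiv.Perm.filter_parts_partition_eq_cycleType]
    · intro h
      have hsplit := Multiset.filter_add_not (fun n => 2 ≤ n) π.parts
      have hone : π.parts.filter (fun n => ¬ 2 ≤ n) =
          Multiset.replicate (π.parts.count 1) 1 := by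
        rw [← Multiset.filter_eq' π.parts 1]
        refine Multiset.filter_congr fun i hi => ?_
        have := π.parts_pos hi
        omega
      have hs := congrArg Multiset.sum hsplit
      rw [Multiset.sum_add, hone, π.parts_sum, ← h, Equiv.Perm.sum_cycleType] at hs
      simp at hs
      rw [Equiv.Perm.parts_partition, h]
      conv_rhs => rw [← hsplit, hone]
      congr 2
      simp
      omega
  rw [Finset.filter_congr fun τ _ => key τ, Equiv.Perm.card_of_cycleType, if_pos, permTypeCount,
    prod_permType_eq, Fintype.card_fin]
  exact ⟨by simpa using hle, fun a ha => (Multiset.mem_filter.1 ha).2⟩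

/-- `C_k(t₁, …, t_k) = ∑ N(c₁, …, c_k) t₁^{c₁} ⋯ t_k^{c_k}`, the sum over all `(c₁, …, c_k)` of
nonnegative integers with `∑ i cᵢ = k`. Such tuples are the partitions of `k`, where `cᵢ` is the
number of parts equal to `i`. -/
noncomputable def cycleGen (k : ℕ) (t : ℕ → ℂ) : ℂ :=
  ∑ π : Nat.Partition k,
    (permTypeCount k (fun i => π.parts.count i) : ℂ) *
      ∏ i ∈ Finset.Icc 1 k, t i ^ π.parts.count i

/-- `A_{k,b}(u, v, w) = C_k(t₁, …, t_k)` for a finite field `F` of odd characteristic `p` with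
quadratic character `χ` and `b ≠ 0`, where `tᵢ = w` if `p ∣ i`, and otherwise `tᵢ = u` if
`χ(i) = χ(b)` and `tᵢ = v` if `χ(i) = -χ(b)`. -/
noncomputable def cycleGenQuad (F : Type*) [Field F] [Fintype F] [DecidableEq F] (p k : ℕ) (b : F)
    (u v w : ℂ) : ℂ :=
  cycleGen k (fun i =>
    if p ∣ i then w
    else if quadraticChar F (i : F) = quadraticChar F b then u
    else v)

/-! Fix a primitive additive character `ψ`. Orthogonality gives `q * N_H(k,b) = ∑ a, ψ(-ba) *
e_k(ψ(ah) : h ∈ H)` (`card_mul_subsetSumCount`), where `a = 0` yields the binomial. For `a ≠ 0`,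
`cycleGen_neg_powerSum` writes `(-1)^k * k! * e_k` as the cycle index of the negated power sums.
Since `ψ(ah)^i = ψ(aih)`, these are `(1 - q)/2` if `p ∣ i` and `(1 - χ(ai) * G)/2` otherwise, with
`G` the quadratic Gauss sum. So `e_k` depends on `a` only through `χ(a)`, and the sum over `a`
reduces to `∑ ψ(-ba) = -1` and `∑ χ(a) * ψ(-ba) = χ(-b) * G` over `a ≠ 0`. The result is invariant
under `G ↦ -G`, so `G^2 = χ(-1) * q` suffices and the sign of `G` is never determined. -/

theorem permTypeCount_mul_prod {k : ℕ} (π : Nat.Partition k) :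
    permTypeCount k (fun i => π.parts.count i) *
      ∏ i ∈ Finset.Icc 1 k, (i ^ π.parts.count i * (π.parts.count i)!) = k ! := by
  refine Nat.div_mul_cancel ?_
  have hle : (π.parts.filter (fun n => 2 ≤ n)).sum ≤ k := by
    have h := congrArg Multiset.sum (Multiset.filter_add_not (fun n => 2 ≤ n) π.parts)
    rw [Multiset.sum_add, π.parts_sum] at h
    omega
  have h := Equiv.Perm.card_of_cycleType_mul_eq (Fin k) (π.parts.filter (fun n => 2 ≤ n))
  rw [if_pos ⟨by simpa using hle, fun a ha => (Multiset.mem_filter.1 ha).2⟩,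
    Fintype.card_fin] at h
  rw [prod_permType_eq, ← h]
  exact dvd_mul_left _ _

/-! ### Recursion for the cycle index -/

/-- The factor contributed to a cycle index by `c` cycles of length `i`. -/
noncomputable def cycleFactor (t : ℕ → ℂ) (i c : ℕ) : ℂ :=
  t i ^ c / ((i : ℂ) ^ c * (c ! : ℂ))

theorem cycleFactor_succ (t : ℕ → ℂ) {i : ℕ} (hi : i ≠ 0) (c : ℕ) :
    (i : ℂ) * ((c + 1 : ℕ) : ℂ) * cycleFactor t i (c + 1) = t i * cycleFactor t i c := by
  have hi' : (i : ℂ) ≠ 0 := Nat.cast_ne_zero.2 hi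
  have hc : (c ! : ℂ) ≠ 0 := Nat.cast_ne_zero.2 (Nat.factorial_ne_zero c)
  have hc' : ((c : ℂ) + 1) ≠ 0 := Nat.cast_add_one_ne_zero c
  unfold cycleFactor
  rw [Nat.factorial_succ]
  push_cast
  field_simp
  ring

/-- The weight of a partition of `k`, indexed over any range containing its parts. -/
noncomputable def cycleWeight (t : ℕ → ℂ) (N : ℕ) (m : Multiset ℕ) : ℂ :=
  ∏ i ∈ Finset.Icc 1 N, cycleFactor t i (m.count i)

theorem cycleWeight_eq_of_le (t : ℕ → ℂ) {n N : ℕ} (h : n ≤ N) (π : Nat.Partition n) :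
    cycleWeight t N π.parts = cycleWeight t n π.parts := by
  refine (Finset.prod_subset (Finset.Icc_subset_Icc_right h) fun i _ hi => ?_).symm
  have : i ∉ π.parts := fun hm =>
    hi (Finset.mem_Icc.2 ⟨π.parts_pos hm, Nat.Partition.le_of_mem_parts hm⟩)
  simp [cycleFactor, Multiset.count_eq_zero_of_notMem this]

theorem cycleWeight_cons (t : ℕ → ℂ) {i N : ℕ} (hi : i ∈ Finset.Icc 1 N) (m : Multiset ℕ) :
    (i : ℂ) * ((m.count i + 1 : ℕ) : ℂ) * cycleWeight t N (i ::ₘ m) =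
      t i * cycleWeight t N m := by
  have h0 : i ≠ 0 := by have := (Finset.mem_Icc.1 hi).1; omega
  unfold cycleWeight
  rw [← Finset.mul_prod_erase _ _ hi, ← Finset.mul_prod_erase _ (fun j => cycleFactor t j _) hi,
    ← mul_assoc, ← mul_assoc, Multiset.count_cons_self, cycleFactor_succ t h0]
  congr 1
  refine Finset.prod_congr rfl fun j hj => ?_
  rw [Multiset.count_cons_of_ne (Finset.ne_of_mem_erase hj)]

theorem cycleGen_eq_factorial_mul (k : ℕ) (t : ℕ → ℂ) :
    cycleGen k t = (k ! : ℂ) * ∑ π : Nat.Partition k, cycleWeight t k π.parts := by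
  rw [cycleGen, Finset.mul_sum]
  refine Finset.sum_congr rfl fun π _ => ?_
  have hne : ∏ i ∈ Finset.Icc 1 k, ((i : ℂ) ^ π.parts.count i * ((π.parts.count i)! : ℂ)) ≠ 0 := by
    refine Finset.prod_ne_zero_iff.2 fun i hi => mul_ne_zero (pow_ne_zero _ ?_) ?_
    · have := (Finset.mem_Icc.1 hi).1
      exact Nat.cast_ne_zero.2 (by omega)
    · exact Nat.cast_ne_zero.2 (Nat.factorial_ne_zero _)
  rw [cycleWeight, ← permTypeCount_mul_prod π]
  simp only [cycleFactor, Finset.prod_div_distrib]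
  push_cast
  field_simp

theorem cycleGen_congr {k : ℕ} {t u : ℕ → ℂ} (h : ∀ i, 1 ≤ i → t i = u i) :
    cycleGen k t = cycleGen k u := by
  refine Finset.sum_congr rfl fun π _ => ?_
  congr 1
  exact Finset.prod_congr rfl fun i hi => by rw [h i (Finset.mem_Icc.1 hi).1]

/-- Deleting one part `i` matches the partitions of `k` containing `i` with those of `k - i`; the
factor `i * count i` cancels the resulting change in `i^c * c!`. -/
theorem sum_cycleWeight_with_part (t : ℕ → ℂ) {i k : ℕ} (hi : i ∈ Finset.Icc 1 k) :
    ∑ π : Nat.Partition k, (i : ℂ) * (π.parts.count i : ℂ) * cycleWeight t k π.parts =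
      t i * ∑ π : Nat.Partition (k - i), cycleWeight t (k - i) π.parts := by
  obtain ⟨h1, hk⟩ := Finset.mem_Icc.1 hi
  rw [← Finset.sum_subset (Finset.subset_univ (Finset.univ.filter fun π : Nat.Partition k =>
    i ∈ π.parts)) fun π _ hπ => by
      rw [Multiset.count_eq_zero_of_notMem fun h => hπ (by simpa using h)]; simp]
  rw [Finset.mul_sum]
  symm
  refine Finset.sum_bij' (fun π _ => (⟨i ::ₘ π.parts, ?_, ?_⟩ : Nat.Partition k))
    (fun π hπ => (⟨π.parts.erase i, ?_, ?_⟩ : Nat.Partition (k - i))) ?_ ?_ ?_ ?_ ?_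
  · intro j hj
    rcases Multiset.mem_cons.1 hj with rfl | hj
    · omega
    · exact π.parts_pos hj
  · rw [Multiset.sum_cons, π.parts_sum]; omega
  · intro j hj
    exact π.parts_pos (Multiset.mem_of_mem_erase hj)
  · have := Multiset.sum_erase (Finset.mem_filter.1 hπ).2
    rw [π.parts_sum] at this
    omega
  · intro π _; simp
  · intro π _; simp
  · intro π _; ext1; simp
  · intro π hπ
    ext1
    exact Multiset.cons_erase (Finset.mem_filter.1 hπ).2
  · intro π _
    rw [Multiset.count_cons_self, cycleWeight_cons t hi,
      cycleWeight_eq_of_le t (Nat.sub_le k i)]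

/-- Each partition satisfies `k = ∑ i * count i`; distribute this over its weight and exchange the
sums. -/
theorem mul_sum_cycleWeight (t : ℕ → ℂ) (k : ℕ) :
    (k : ℂ) * ∑ π : Nat.Partition k, cycleWeight t k π.parts =
      ∑ i ∈ Finset.Icc 1 k,
        t i * ∑ π : Nat.Partition (k - i), cycleWeight t (k - i) π.parts := by
  rw [← Finset.sum_congr rfl fun i hi => sum_cycleWeight_with_part t hi, Finset.sum_comm,
    Finset.mul_sum]
  refine Finset.sum_congr rfl fun π _ => ?_
  rw [← Finset.sum_mul]
  congr 1
  have h : ∑ i ∈ Finset.Icc 1 k, π.parts.count i * i = k := by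
    conv_rhs => rw [← π.parts_sum]
    rw [Finset.sum_multiset_count_of_subset π.parts (Finset.Icc 1 k) fun i hi => by
      rw [Multiset.mem_toFinset] at hi
      exact Finset.mem_Icc.2 ⟨π.parts_pos hi, Nat.Partition.le_of_mem_parts hi⟩]
    simp
  conv_lhs => rw [← h]
  push_cast
  exact Finset.sum_congr rfl fun i _ => mul_comm _ _

/-! ### Newton's identities -/

/-- Signs are absorbed so that Newton's identity becomes the recursion of `mul_sum_cycleWeight` with
`t i` the negated power sums. -/
theorem mul_esymm_eq_sum_Icc {σ : Type*} (H : Finset σ) (f : σ → ℂ) (k : ℕ) :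
    (k : ℂ) * ((-1) ^ k * ∑ S ∈ H.powersetCard k, ∏ h ∈ S, f h) =
      ∑ i ∈ Finset.Icc 1 k, (-∑ h ∈ H, f h ^ i) *
        ((-1) ^ (k - i) * ∑ S ∈ H.powersetCard (k - i), ∏ h ∈ S, f h) := by
  have he : ∀ n, MvPolynomial.aeval (fun x : H => f x) (MvPolynomial.esymm H ℂ n) =
      ∑ S ∈ H.powersetCard n, ∏ h ∈ S, f h := fun n => by
    rw [MvPolynomial.aeval_esymm_eq_multiset_esymm, ← Finset.esymm_map_val f H n]
    congr 1
    exact Multiset.attach_map_val' H.val f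
  have hp : ∀ n, MvPolynomial.aeval (fun x : H => f x) (MvPolynomial.psum H ℂ n) =
      ∑ h ∈ H, f h ^ n := fun n => by
    simp [MvPolynomial.psum, Finset.sum_attach H (fun h => f h ^ n)]
  have h := congrArg (MvPolynomial.aeval (fun x : H => f x)) (MvPolynomial.mul_esymm_eq_sum H ℂ k)
  simp only [map_mul, map_natCast, map_pow, map_neg, map_one, map_sum, he, hp] at h
  rw [mul_left_comm, h, ← mul_assoc, ← pow_add, show k + (k + 1) = 2 * k + 1 by ring, pow_succ,
    pow_mul, neg_one_sq, one_pow, one_mul, neg_one_mul, ← Finset.sum_neg_distrib]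
  refine Finset.sum_bij' (fun a _ => a.2) (fun i _ => (k - i, i)) ?_ ?_ ?_ ?_ ?_
  · intro a ha
    simp only [Finset.mem_filter, Finset.HasAntidiagonal.mem_antidiagonal] at ha
    exact Finset.mem_Icc.2 (by omega)
  · intro i hi
    have := Finset.mem_Icc.1 hi
    simp only [Finset.mem_filter, Finset.HasAntidiagonal.mem_antidiagonal]
    omega
  · rintro ⟨x, y⟩ ha
    simp only [Finset.mem_filter, Finset.HasAntidiagonal.mem_antidiagonal] at ha
    ext <;> simp only
    omega
  · intro i _; rfl
  · rintro ⟨x, y⟩ ha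
    simp only [Finset.mem_filter, Finset.HasAntidiagonal.mem_antidiagonal] at ha
    obtain rfl : x = k - y := by omega
    simp only
    ring

/-- Elementary symmetric sums in terms of power sums, through the cycle index. -/
theorem cycleGen_neg_powerSum {σ : Type*} (H : Finset σ) (f : σ → ℂ) (k : ℕ) :
    cycleGen k (fun i => -∑ h ∈ H, f h ^ i) =
      (k ! : ℂ) * ((-1) ^ k * ∑ S ∈ H.powersetCard k, ∏ h ∈ S, f h) := by
  rw [cycleGen_eq_factorial_mul]
  congr 1
  induction k using Nat.strong_induction_on with
  | _ k ih =>
    rcases Nat.eq_zero_or_pos k with rfl | hk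
    · simp [cycleWeight]
    · refine mul_left_cancel₀ (Nat.cast_ne_zero.2 hk.ne' : (k : ℂ) ≠ 0) ?_
      rw [mul_sum_cycleWeight, mul_esymm_eq_sum_Icc]
      refine Finset.sum_congr rfl fun i hi => ?_
      have := Finset.mem_Icc.1 hi
      rw [ih (k - i) (by omega)]

/-! ### Character sums over the nonzero squares -/

section

variable {F : Type*} [Field F] [Fintype F] [DecidableEq F]

theorem mem_nonzeroSquares {x : F} : x ∈ nonzeroSquares F ↔ x ≠ 0 ∧ quadraticChar F x = 1 := by
  simp only [nonzeroSquares, Finset.mem_image, Finset.mem_filter, Finset.mem_univ, true_and]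
  constructor
  · rintro ⟨y, hy, rfl⟩
    have h := pow_ne_zero 2 hy
    exact ⟨h, (quadraticChar_one_iff_isSquare h).2 (IsSquare.sq y)⟩
  · rintro ⟨hx, h⟩
    obtain ⟨y, rfl⟩ := (quadraticChar_one_iff_isSquare hx).1 h
    exact ⟨y, fun h0 => hx (by simp [h0]), sq y⟩

/-- Away from `0`, `1 + χ` is twice the indicator of the squares; at `0` it equals `1`, which is
subtracted. -/
theorem two_mul_sum_nonzeroSquares (g : F → ℂ) :
    2 * ∑ x ∈ nonzeroSquares F, g x =
      ∑ x, g x + ∑ x, (quadraticChar F x : ℂ) * g x - g 0 := by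
  have h0 : g 0 = ∑ x : F, if x = 0 then g x else 0 := by simp
  rw [h0, ← Finset.sum_add_distrib, ← Finset.sum_sub_distrib, Finset.mul_sum,
    ← Finset.sum_subset (Finset.subset_univ (nonzeroSquares F))]
  · refine Finset.sum_congr rfl fun x hx => ?_
    obtain ⟨hx0, hx1⟩ := mem_nonzeroSquares.1 hx
    rw [if_neg hx0, hx1]
    push_cast
    ring
  · intro x _ hx
    by_cases hx0 : x = 0
    · simp [hx0]
    · rcases quadraticChar_dichotomy hx0 with h | h
      · exact absurd (mem_nonzeroSquares.2 ⟨hx0, h⟩) hx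
      · simp [hx0, h]

/-- The complex-valued quadratic character. -/
noncomputable abbrev quadraticCharComplex (F : Type*) [Field F] [Fintype F] [DecidableEq F] :
    MulChar F ℂ :=
  (quadraticChar F).ringHomComp (Int.castRingHom ℂ)

theorem quadraticCharComplex_apply (x : F) :
    quadraticCharComplex F x = (quadraticChar F x : ℂ) := rfl

theorem quadraticChar_cast_sq {x : F} (hx : x ≠ 0) : (quadraticChar F x : ℂ) ^ 2 = 1 := by
  exact_mod_cast quadraticChar_sq_one hx

theorem sum_quadraticChar_mul_addChar (ψ : AddChar F ℂ) {c : F} (hc : c ≠ 0) :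
    ∑ x, (quadraticChar F x : ℂ) * ψ (c * x) =
      (quadraticChar F c : ℂ) * gaussSum (quadraticCharComplex F) ψ := by
  have h := gaussSum_mulShift (quadraticCharComplex F) ψ (Units.mk0 c hc)
  rw [← h, Units.val_mk0, quadraticCharComplex_apply, ← mul_assoc, ← sq, quadraticChar_cast_sq hc,
    one_mul]
  rfl

theorem sum_addChar_mul_of_ne_zero {ψ : AddChar F ℂ} (hψ : ψ.IsPrimitive) {c : F} (hc : c ≠ 0) :
    ∑ x, ψ (c * x) = 0 := by
  have h := AddChar.sum_mulShift c hψ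
  simp only [mul_comm _ c] at h
  simpa [hc] using h

theorem two_mul_sum_nonzeroSquares_addChar {ψ : AddChar F ℂ} (hψ : ψ.IsPrimitive) {c : F}
    (hc : c ≠ 0) :
    2 * ∑ x ∈ nonzeroSquares F, ψ (c * x) =
      (quadraticChar F c : ℂ) * gaussSum (quadraticCharComplex F) ψ - 1 := by
  rw [two_mul_sum_nonzeroSquares, sum_addChar_mul_of_ne_zero hψ hc,
    sum_quadraticChar_mul_addChar ψ hc]
  simp

theorem two_mul_card_nonzeroSquares (hF : ringChar F ≠ 2) :
    2 * ((nonzeroSquares F).card : ℂ) = (Fintype.card F : ℂ) - 1 := by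
  have h := two_mul_sum_nonzeroSquares (F := F) fun _ => 1
  have h' : (∑ x : F, (quadraticChar F x : ℂ)) = 0 := by
    exact_mod_cast quadraticChar_sum_zero hF
  simp only [mul_one, h', Finset.sum_const, nsmul_eq_mul, add_zero, Finset.card_univ] at h
  exact h

theorem gaussSum_quadratic_sq (hF : ringChar F ≠ 2) {ψ : AddChar F ℂ} (hψ : ψ.IsPrimitive) :
    gaussSum (quadraticCharComplex F) ψ ^ 2 = (quadraticChar F (-1) : ℂ) * Fintype.card F := by
  refine gaussSum_sq ?_ ((quadraticChar_isQuadratic F).comp _) hψ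
  exact (MulChar.ringHomComp_ne_one_iff (RingHom.injective_int _)).2 (quadraticChar_ne_one hF)

/-! ### Counting by orthogonality -/

theorem card_mul_subsetSumCount {ψ : AddChar F ℂ} (hψ : ψ.IsPrimitive) (H : Finset F) (k : ℕ)
    (b : F) :
    (Fintype.card F : ℂ) * subsetSumCount H k b =
      ∑ a, ψ (-b * a) * ∑ S ∈ H.powersetCard k, ∏ h ∈ S, ψ (a * h) := by
  simp_rw [Finset.mul_sum]
  rw [Finset.sum_comm, subsetSumCount, Finset.card_filter, Nat.cast_sum, Finset.mul_sum]
  refine Finset.sum_congr rfl fun S _ => ?_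
  have h := AddChar.sum_mulShift (∑ x ∈ S, x - b) hψ
  have h2 : ∀ a, ψ (-b * a) * ∏ h ∈ S, ψ (a * h) = ψ (a * (∑ x ∈ S, x - b)) := fun a => by
    have : ∏ h ∈ S, ψ (a * h) = ψ (∑ h ∈ S, a * h) := by
      clear * -
      induction S using Finset.induction_on with
      | empty => simp
      | insert x S hx ih => rw [Finset.prod_insert hx, Finset.sum_insert hx, ψ.map_add_eq_mul, ih]
    rw [this, ← ψ.map_add_eq_mul, ← Finset.mul_sum]
    congr 1
    ring
  simp_rw [h2]
  rw [h]
  simp [sub_eq_zero]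

/-- `A_{k,b}` at the values attached to a square root `z` of `χ(-1) q`. -/
noncomputable def cycleGenQuadRoot (F : Type*) [Field F] [Fintype F] [DecidableEq F] (p k : ℕ)
    (b : F) (z : ℂ) : ℂ :=
  cycleGenQuad F p k b ((1 - z) / 2) ((1 + z) / 2) ((1 - (Fintype.card F : ℂ)) / 2)

variable {p : ℕ} [CharP F p]

theorem neg_powerSum_nonzeroSquares (hF : ringChar F ≠ 2) {ψ : AddChar F ℂ}
    (hψ : ψ.IsPrimitive) {a : F} (ha : a ≠ 0) (i : ℕ) :
    -∑ h ∈ nonzeroSquares F, ψ (a * h) ^ i =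
      if p ∣ i then (1 - (Fintype.card F : ℂ)) / 2
      else (1 - (quadraticChar F a : ℂ) * (quadraticChar F (i : F) : ℂ) *
        gaussSum (quadraticCharComplex F) ψ) / 2 := by
  have hpow : ∀ h, ψ (a * h) ^ i = ψ (a * (i : F) * h) := fun h => by
    rw [← ψ.map_nsmul_eq_pow, nsmul_eq_mul]
    congr 1
    ring
  simp_rw [hpow]
  split_ifs with hpi
  · have := two_mul_card_nonzeroSquares hF
    simp only [(CharP.cast_eq_zero_iff F p i).2 hpi, mul_zero, zero_mul, AddChar.map_zero_eq_one,
      Finset.sum_const, nsmul_eq_mul, mul_one]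
    linear_combination (-1 / 2 : ℂ) * this
  · have hi : (i : F) ≠ 0 := fun h => hpi ((CharP.cast_eq_zero_iff F p i).1 h)
    have := two_mul_sum_nonzeroSquares_addChar hψ (mul_ne_zero ha hi)
    rw [map_mul] at this
    push_cast at this
    linear_combination (-1 / 2 : ℂ) * this

/-- As `χ(i) = ±χ(b)`, comparing with `b` turns `χ(a) * χ(i) * G` into `±z` for `z = χ(a) * χ(b) *
G`, independent of `i`. -/
theorem cycleGen_neg_powerSum_nonzeroSquares (hF : ringChar F ≠ 2) {ψ : AddChar F ℂ}
    (hψ : ψ.IsPrimitive) {a b : F} (ha : a ≠ 0) (hb : b ≠ 0) (k : ℕ) :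
    cycleGen k (fun i => -∑ h ∈ nonzeroSquares F, ψ (a * h) ^ i) =
      cycleGenQuadRoot F p k b ((quadraticChar F a : ℂ) * (quadraticChar F b : ℂ) *
        gaussSum (quadraticCharComplex F) ψ) := by
  refine cycleGen_congr fun i _ => ?_
  rw [neg_powerSum_nonzeroSquares (p := p) hF hψ ha i]
  by_cases hpi : p ∣ i
  · simp [hpi]
  have hi : (i : F) ≠ 0 := fun h => hpi ((CharP.cast_eq_zero_iff F p i).1 h)
  simp only [hpi, if_false]
  rcases quadraticChar_dichotomy hi with h1 | h1 <;>
    rcases quadraticChar_dichotomy hb with h2 | h2 <;> simp [h1, h2, sub_eq_add_neg]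

theorem card_mul_subsetSumCount_nonzeroSquares (hF : ringChar F ≠ 2) {ψ : AddChar F ℂ}
    (hψ : ψ.IsPrimitive) {b : F} (hb : b ≠ 0) (k : ℕ) {G : ℂ}
    (hG : gaussSum (quadraticCharComplex F) ψ = G) :
    (Fintype.card F : ℂ) * subsetSumCount (nonzeroSquares F) k b =
      ((nonzeroSquares F).card.choose k : ℂ) - (-1) ^ k / (2 * (k ! : ℂ)) *
        ((1 - (quadraticChar F (-1) : ℂ) * G) * cycleGenQuadRoot F p k b G +
          (1 + (quadraticChar F (-1) : ℂ) * G) * cycleGenQuadRoot F p k b (-G)) := by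
  have hk : (k ! : ℂ) ≠ 0 := Nat.cast_ne_zero.2 (Nat.factorial_ne_zero k)
  have hs : ((-1 : ℂ) ^ k) * (-1) ^ k = 1 := by rw [← mul_pow]; simp
  set P := cycleGenQuadRoot F p k b G
  set M := cycleGenQuadRoot F p k b (-G)
  have hterm : ∀ a ∈ Finset.univ.erase (0 : F),
      ψ (-b * a) * ∑ S ∈ (nonzeroSquares F).powersetCard k, ∏ h ∈ S, ψ (a * h) =
        (-1) ^ k / (2 * (k ! : ℂ)) * ((P + M) * ψ (-b * a) +
          (quadraticChar F b : ℂ) * (P - M) * ((quadraticChar F a : ℂ) * ψ (-b * a))) := by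
    intro a ha
    have ha := Finset.ne_of_mem_erase ha
    have h1 := cycleGen_neg_powerSum_nonzeroSquares (p := p) hF hψ ha hb k
    rw [cycleGen_neg_powerSum, hG] at h1
    -- A function of a sign `ε` is affine in `ε`; here `ε = χ(a) * χ(b)`, with values `P` and `M` at
    -- `±1`.
    have h2 : (2 : ℂ) * cycleGenQuadRoot F p k b
          ((quadraticChar F a : ℂ) * (quadraticChar F b : ℂ) * G) =
        P + M + (quadraticChar F b : ℂ) * (P - M) * (quadraticChar F a : ℂ) := by
      rcases quadraticChar_dichotomy ha with h1 | h1 <;>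
        rcases quadraticChar_dichotomy hb with h2 | h2 <;> simp [h1, h2, P, M] <;> ring
    rw [← h1] at h2
    field_simp
    linear_combination (ψ (-(b * a)) * (-1) ^ k) * h2 - (2 * ψ (-(b * a)) * k ! *
      ∑ S ∈ (nonzeroSquares F).powersetCard k, ∏ h ∈ S, ψ (a * h)) * hs
  have hnb : -b ≠ 0 := neg_ne_zero.2 hb
  rw [card_mul_subsetSumCount hψ, ← Finset.add_sum_erase _ _ (Finset.mem_univ (0 : F)),
    Finset.sum_congr rfl hterm, ← Finset.mul_sum, Finset.sum_add_distrib, ← Finset.mul_sum,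
    ← Finset.mul_sum]
  have hA : ∑ a ∈ Finset.univ.erase (0 : F), ψ (-b * a) = -1 := by
    have := sum_addChar_mul_of_ne_zero hψ hnb
    rw [← Finset.add_sum_erase _ _ (Finset.mem_univ (0 : F)), mul_zero,
      AddChar.map_zero_eq_one] at this
    linear_combination this
  have hB : ∑ a ∈ Finset.univ.erase (0 : F), (quadraticChar F a : ℂ) * ψ (-b * a) =
      (quadraticChar F (-1) : ℂ) * (quadraticChar F b : ℂ) * G := by
    have := sum_quadraticChar_mul_addChar ψ hnb
    rw [← Finset.add_sum_erase _ _ (Finset.mem_univ (0 : F)), hG, ← neg_one_mul b, map_mul (quadraticChar F),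
      MulChar.map_zero] at this
    push_cast at this
    rwa [zero_mul, zero_add, neg_one_mul] at this
  rw [hA, hB]
  have h0 : ψ (-b * 0) * ∑ S ∈ (nonzeroSquares F).powersetCard k, ∏ h ∈ S, ψ (0 * h) =
      ((nonzeroSquares F).card.choose k : ℂ) := by
    simp
  rw [h0]
  have hb2 := quadraticChar_cast_sq hb
  linear_combination (-1) ^ k / (2 * (k ! : ℂ)) * (P - M) * (quadraticChar F (-1) : ℂ) * G * hb2

/-- The count is symmetric in the two square roots of `χ(-1) q`, so the sign of the Gauss sum does
not matter. -/
theorem subsetSumCount_nonzeroSquares (hF : ringChar F ≠ 2) {b : F} (hb : b ≠ 0) (k : ℕ) {z : ℂ}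
    (hz : z ^ 2 = (quadraticChar F (-1) : ℂ) * Fintype.card F) :
    (subsetSumCount (nonzeroSquares F) k b : ℂ) =
      1 / (Fintype.card F : ℂ) * (((Fintype.card F - 1) / 2).choose k : ℂ) -
        (-1) ^ k / (2 * (Fintype.card F : ℂ) * (k ! : ℂ)) *
        ((1 - (quadraticChar F (-1) : ℂ) * z) * cycleGenQuadRoot F p k b z +
          (1 + (quadraticChar F (-1) : ℂ) * z) * cycleGenQuadRoot F p k b (-z)) := by
  have hψ := AddChar.FiniteField.primitiveChar_to_Complex_isPrimitive F
  have hk : (k ! : ℂ) ≠ 0 := Nat.cast_ne_zero.2 (Nat.factorial_ne_zero k)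
  have hq : (Fintype.card F : ℂ) ≠ 0 := Nat.cast_ne_zero.2 Fintype.card_ne_zero
  have hcard : (nonzeroSquares F).card = (Fintype.card F - 1) / 2 := by
    have h := two_mul_card_nonzeroSquares hF
    have h' : 2 * (nonzeroSquares F).card + 1 = Fintype.card F := by
      have : (2 * ((nonzeroSquares F).card : ℂ) + 1) = Fintype.card F := by rw [h]; ring
      exact_mod_cast this
    omega
  refine mul_left_cancel₀ hq ?_
  -- `G = ±z`, and `z ↦ -z` only swaps the two summands.
  rcases sq_eq_sq_iff_eq_or_eq_neg.1 ((gaussSum_quadratic_sq hF hψ).trans hz.symm) with h | h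
  · rw [card_mul_subsetSumCount_nonzeroSquares (p := p) hF hψ hb k h, hcard]
    field_simp
  · rw [card_mul_subsetSumCount_nonzeroSquares (p := p) hF hψ hb k h, hcard, neg_neg]
    field_simp
    ring

end

theorem theorem5p1 (F : Type*) [Field F] [Fintype F] [DecidableEq F] (p s q : ℕ)
    (hp : p.Prime) (hp2 : p ≠ 2) (hq : q = p ^ s) (hF : Fintype.card F = q)
    (k : ℕ) (b : F) (hb : b ≠ 0) :
    ((p % 4 = 1 ∨ (p % 4 = 3 ∧ Even s)) →
      (subsetSumCount (nonzeroSquares F) k b : ℂ) =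
        1 / (q : ℂ) * (((q - 1) / 2).choose k : ℂ) -
          (-1) ^ k / (2 * (q : ℂ) * (k ! : ℂ)) *
            ((1 - (√(q : ℝ) : ℂ)) *
                cycleGenQuad F p k b ((1 - (√(q : ℝ) : ℂ)) / 2) ((1 + (√(q : ℝ) : ℂ)) / 2)
                  ((1 - (q : ℂ)) / 2) +
              (1 + (√(q : ℝ) : ℂ)) *
                cycleGenQuad F p k b ((1 + (√(q : ℝ) : ℂ)) / 2) ((1 - (√(q : ℝ) : ℂ)) / 2)
                  ((1 - (q : ℂ)) / 2))) ∧
    ((p % 4 = 3 ∧ Odd s) →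
      (subsetSumCount (nonzeroSquares F) k b : ℂ) =
        1 / (q : ℂ) * (((q - 1) / 2).choose k : ℂ) -
          (-1) ^ k / (2 * (q : ℂ) * (k ! : ℂ)) *
            ((1 + (√(q : ℝ) : ℂ) * Complex.I) *
                cycleGenQuad F p k b ((1 - (√(q : ℝ) : ℂ) * Complex.I) / 2)
                  ((1 + (√(q : ℝ) : ℂ) * Complex.I) / 2) ((1 - (q : ℂ)) / 2) +
              (1 - (√(q : ℝ) : ℂ) * Complex.I) *
                cycleGenQuad F p k b ((1 + (√(q : ℝ) : ℂ) * Complex.I) / 2)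
                  ((1 - (√(q : ℝ) : ℂ) * Complex.I) / 2) ((1 - (q : ℂ)) / 2))) := by

  have : Fact p.Prime := ⟨hp⟩
  have hcard : Fintype.card F = p ^ s := hF.trans hq
  have : CharP F p := charP_of_card_eq_prime_pow hcard
  have hchar : ringChar F ≠ 2 := by rwa [ringChar.eq F p]
  have hsqrt : (√(q : ℝ) : ℂ) ^ 2 = (q : ℂ) := by
    rw [← Complex.ofReal_pow, Real.sq_sqrt (Nat.cast_nonneg q), Complex.ofReal_natCast]
  constructor
  · intro h
    have hmod : q % 4 = 1 := by
      rw [hq, Nat.pow_mod]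
      rcases h with h | ⟨h, m, rfl⟩
      · simp [h]
      · rw [h, ← two_mul, pow_mul, Nat.pow_mod]
        simp
    have hχ : quadraticChar F (-1) = 1 := by
      rw [quadraticChar_neg_one hchar, hF, ZMod.χ₄_nat_one_mod_four hmod]
    have hmain := subsetSumCount_nonzeroSquares (p := p) hchar hb k
      (z := (√(q : ℝ) : ℂ)) (by rw [hsqrt, hχ, hF]; simp)
    rw [hmain, hχ, hF]
    simp only [cycleGenQuadRoot, hF, Int.cast_one, one_mul, sub_neg_eq_add, ← sub_eq_add_neg]
  · rintro ⟨h, m, rfl⟩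
    have hmod : q % 4 = 3 := by
      rw [hq, Nat.pow_mod, h, pow_succ, pow_mul, Nat.mul_mod, Nat.pow_mod]
      simp
    have hχ : quadraticChar F (-1) = -1 := by
      rw [quadraticChar_neg_one hchar, hF, ZMod.χ₄_nat_three_mod_four hmod]
    -- Here `χ(-1) = -1` makes the outer factor `1 + z` while the first argument stays `(1 - z)/2`,
    -- unlike in the real case.
    have hmain := subsetSumCount_nonzeroSquares (p := p) hchar hb k
      (z := (√(q : ℝ) : ℂ) * Complex.I) (by rw [mul_pow, hsqrt, hχ, hF, Complex.I_sq]; simp)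
    rw [hmain, hχ, hF]
    simp only [cycleGenQuadRoot, hF, Int.cast_neg, Int.cast_one, neg_mul, one_mul, sub_neg_eq_add,
      ← sub_eq_add_neg]
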